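/- **Corollary (ratio (1.567, 1.567)).** An instance of the $k$ disjoint bi-constraint path problem ($k$BCP) consists of a finite directed graph $G=(V,E)$ (parallel edges allowed) with $n$ vertices and $m$ edges, vertices $s\neq t$, a number $k$, a cost $c(e)\ge 0$ and a delay $d(e)\ge 0$ for every edge, and real bounds $C,D>0$. It is feasible if there are $k$ pairwise edge-disjoint $st$-paths with cost sum at most $C$ and delay sum at most $D$. An algorithm is a bifactor $(a,b)$-approximation if on every feasible instance it terminates and returns $k$ edge-disjoint $st$-paths whose delay sum is at most $aD$ and whose cost sum is at most $bC$. For a parameter $\beta>0$ consider the following algorithm. 1. Compute $k$ edge-disjoint $st$-paths $P=(P_1,\dots,P_k)$ minimizing $\sum_i\sum_{e\in P_i}\bigl(\tfrac{c(e)}{C}+\tfrac{d(e)}{D}\bigr)$. If $c(P)/C\le d(P)/D$, continue with step 2; if $d(P)/D\le c(P)/C$, exchange the roles of $(c,C)$ and $(d,D)$ in steps 2–4. (If both hold, either choice may be made.) 2. If $d(P)\le(1+\beta)D$, return $P$. 3. Let $\overline G$ be $G$ with the edges of $P$ reversed, their delay negated and their cost set to a constant $\varepsilon$. Here $\varepsilon=0$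 or, if all costs, delays and bounds are integers, $\varepsilon$ is any number with $0<\varepsilon<\frac1{mnD}$ (with the roles of $C$ and $D$ exchanged as above). Among the cycles $O$ of $\overline G$ with $d(O)<0$ whose non-reversed edges have total cost at most $C$, choose one minimizing $d(O)/c(O)$ (regarded as $-\infty$ if $c(O)=0$). 4. Add the edges of $O$ to those of $P$, remove the pairs consisting of an edge of $P$ and its reversal, replace $P$ by $k$ edge-disjoint $st$-paths composed of the remaining edges (left-over cycles are dropped), and go to step 2. There is exactly one $\beta>0$ with $1+\ln\frac1\beta=1+\beta$. It satisfies $|(1+\beta)-1.567|<0.0005$, and for this $\beta$ the algorithm, whichever of the permitted choices it makes, is a bifactor $(1+\beta,\,1+\beta)$-approximation for $k$BCP, i.e. a $(1.567,1.567)$-approximation with the ratio rounded to three decimals. -/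

import Mathlib

namespace KBCP

/-- `p` is a walk from `u` to `v`, given by its list of edges, in the directed multigraph whose
edge `e` leads from `src e` to `tgt e`. -/
def IsWalk {V E : Type*} (src tgt : E → V) : V → List E → V → Prop
  | u, [], v => u = v
  | u, e :: p, v => src e = u ∧ IsWalk src tgt (tgt e) p v

/-- A walk from `u` to `v` that visits no vertex twice. -/
def IsPath {V E : Type*} (src tgt : E → V) (u : V) (p : List E) (v : V) : Prop :=
  IsWalk src tgt u p v ∧ (u :: p.map tgt).Nodup

/-- A nonempty closed walk that visits no vertex twice (except that it returns to its start). -/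
def IsCycle {V E : Type*} (src tgt : E → V) (p : List E) : Prop :=
  p ≠ [] ∧ (∃ u, IsWalk src tgt u p u) ∧ (p.map tgt).Nodup

/-- The sum of the edge weights `w` along a list of edges. -/
def weight {E : Type*} (w : E → ℝ) (p : List E) : ℝ := (p.map w).sum

/-- The total weight of `k` lists of edges. -/
def total {E : Type*} {k : ℕ} (w : E → ℝ) (P : Fin k → List E) : ℝ := ∑ i, weight w (P i)

/-- The set of all edges of `P 0, …, P (k - 1)`. -/
def edges {E : Type*} [DecidableEq E] {k : ℕ} (P : Fin k → List E) : Finset E :=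
  Finset.univ.biUnion fun i => (P i).toFinset

/-- An instance of the problem of finding `k` disjoint bi-constrained paths: a directed multigraph
with vertices `V` and edges `E`, terminals `s ≠ t`, an edge cost and an edge delay, a cost bound
`C` and a delay bound `D`. -/
structure Problem (V E : Type*) (k : ℕ) where
  src : E → V
  tgt : E → V
  s : V
  t : V
  s_ne_t : s ≠ t
  cost : E → ℝ
  delay : E → ℝ
  cost_nonneg : ∀ e, 0 ≤ cost e
  delay_nonneg : ∀ e, 0 ≤ delay e
  C : ℝ
  D : ℝ
  C_pos : 0 < C
  D_pos : 0 < D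

namespace Problem

variable {V E : Type*} {k : ℕ}

/-- `P` consists of `k` pairwise edge-disjoint `st`-paths. -/
def DisjointPaths (I : Problem V E k) (P : Fin k → List E) : Prop :=
  (∀ i, IsPath I.src I.tgt I.s (P i) I.t) ∧ Pairwise fun i j => (P i).Disjoint (P j)

/-- Some `k` disjoint `st`-paths satisfy both bounds. -/
def Feasible (I : Problem V E k) : Prop :=
  ∃ P, I.DisjointPaths P ∧ total I.cost P ≤ I.C ∧ total I.delay P ≤ I.D

/-- All costs and delays and both bounds are integers. -/
def Integral (I : Problem V E k) : Prop :=
  (∀ e, ∃ z : ℤ, I.cost e = z) ∧ (∀ e, ∃ z : ℤ, I.delay e = z) ∧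
    (∃ z : ℤ, I.C = z) ∧ ∃ z : ℤ, I.D = z

/-- The same instance with the roles of cost and delay exchanged. -/
def swap (I : Problem V E k) : Problem V E k where
  src := I.src
  tgt := I.tgt
  s := I.s
  t := I.t
  s_ne_t := I.s_ne_t
  cost := I.delay
  delay := I.cost
  cost_nonneg := I.delay_nonneg
  delay_nonneg := I.cost_nonneg
  C := I.D
  D := I.C
  C_pos := I.D_pos
  D_pos := I.C_pos

/-- A possible output of the basic algorithm: `k` disjoint `st`-paths of minimum total mixed cost
`b(e) = c(e)/C + d(e)/D`. -/
def BasicOutput (I : Problem V E k) (P : Fin k → List E) : Prop :=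
  I.DisjointPaths P ∧ ∀ Q, I.DisjointPaths Q →
    total (fun e => I.cost e / I.C + I.delay e / I.D) P ≤
      total (fun e => I.cost e / I.C + I.delay e / I.D) Q

/-- Tail of an edge after reversing the edges in `F`. -/
def resSrc [DecidableEq E] (I : Problem V E k) (F : Finset E) (e : E) : V :=
  if e ∈ F then I.tgt e else I.src e

/-- Head of an edge after reversing the edges in `F`. -/
def resTgt [DecidableEq E] (I : Problem V E k) (F : Finset E) (e : E) : V :=
  if e ∈ F then I.src e else I.tgt e

/-- Residual cost: the reversed edges get cost `ρ`. -/
def resCost [DecidableEq E] (I : Problem V E k) (ρ : ℝ) (F : Finset E) (e : E) : ℝ :=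
  if e ∈ F then ρ else I.cost e

/-- Residual delay: the reversed edges get the negative of their delay. -/
def resDelay [DecidableEq E] (I : Problem V E k) (F : Finset E) (e : E) : ℝ :=
  if e ∈ F then -I.delay e else I.delay e

/-- `O` is a cycle of the residual graph in which `F` is reversed, of negative delay, whose
non-reversed edges cost at most `C` altogether. -/
def Candidate [DecidableEq E] (I : Problem V E k) (F : Finset E) (O : List E) : Prop :=
  IsCycle (I.resSrc F) (I.resTgt F) O ∧
    weight (I.resCost 0 F) O ≤ I.C ∧ weight (I.resDelay F) O < 0

/-- `O` is a candidate with minimum ratio `d(O)/c(O)`. The comparison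
`d(O)/c(O) ≤ d(O')/c(O')` is cleared of denominators; as all delays here are negative and all
costs nonnegative, a candidate of cost `0` thereby has ratio `-∞`. -/
def BestCycle [DecidableEq E] (I : Problem V E k) (ρ : ℝ) (F : Finset E) (O : List E) : Prop :=
  I.Candidate F O ∧ ∀ O', I.Candidate F O' →
    weight (I.resDelay F) O * weight (I.resCost ρ F) O' ≤
      weight (I.resDelay F) O' * weight (I.resCost ρ F) O

/-- One iteration of cycle cancellation, from the paths `P` to the paths `P'`: add the edges of a
best cycle `O` to those of `P`, remove the pairs of opposite edges, and take `k` disjoint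
`st`-paths composed of the remaining edges (the edges left over form cycles, and are dropped). -/
def Improve [DecidableEq E] (I : Problem V E k) (ρ : ℝ) (P P' : Fin k → List E) : Prop :=
  ∃ O, I.BestCycle ρ (edges P) O ∧ I.DisjointPaths P' ∧
    edges P' ⊆ symmDiff (edges P) O.toFinset

/-- The permitted costs of reversed edges: `0`, or, for integral data, any `ρ` with
`0 < ρ < 1/(mnD)` where `n` is the number of vertices and `m` the number of edges. -/
def ReverseCost [Fintype V] [Fintype E] (I : Problem V E k) (ρ : ℝ) : Prop :=
  ρ = 0 ∨ (I.Integral ∧ 0 < ρ ∧ ρ * (Fintype.card E * Fintype.card V * I.D) < 1)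

end Problem

/-- A procedure that may make nondeterministic choices, with outputs in `Out`. -/
structure Procedure (Out : Type*) where
  State : Type*
  start : State
  Step : State → State → Prop
  output : State → Option Out

/-- Whatever choices are made, the procedure terminates, a run only stops after delivering an
output, and every output delivered satisfies `Good`. -/
def Procedure.Computes {Out : Type*} (A : Procedure Out) (Good : Out → Prop) : Prop :=
  Acc (fun σ' σ => A.Step σ σ') A.start ∧
    ∀ σ, Relation.ReflTransGen A.Step A.start σ →
      ((∃ σ', A.Step σ σ') ∨ (A.output σ).isSome) ∧ ∀ o ∈ A.output σ, Good o

/-- The quantity that the improving phase reduces. -/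
inductive Target where
  | delay
  | cost

/-- The instance on which the improving phase works: the phase reduces its `delay`. -/
def Problem.toward {V E : Type*} {k : ℕ} (I : Problem V E k) : Target → Problem V E k
  | .delay => I
  | .cost => I.swap

/-- States of the two-sided cycle cancellation algorithm. -/
inductive State (E : Type*) (k : ℕ) where
  | start
  | improving (target : Target) (ρ : ℝ) (P : Fin k → List E)
  | done (P : Fin k → List E)

/-- Transitions of the two-sided cycle cancellation algorithm with parameter `β`. -/
inductive Step {V E : Type*} [Fintype V] [Fintype E] [DecidableEq E] {k : ℕ}
    (I : Problem V E k) (β : ℝ) : State E k → State E k → Prop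
  /-- Run the basic algorithm; choose the quantity with the worse ratio to its bound. -/
  | init (target : Target) (ρ : ℝ) (P : Fin k → List E) :
      I.BasicOutput P →
      total (I.toward target).cost P / (I.toward target).C ≤
        total (I.toward target).delay P / (I.toward target).D →
      (I.toward target).ReverseCost ρ →
      Step I β .start (.improving target ρ P)
  /-- Return the paths once the chosen quantity is at most `1 + β` times its bound. -/
  | finish (target : Target) (ρ : ℝ) (P : Fin k → List E) :
      total (I.toward target).delay P ≤ (1 + β) * (I.toward target).D →
      Step I β (.improving target ρ P) (.done P)
  /-- Otherwise perform an iteration of cycle cancellation. -/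
  | improve (target : Target) (ρ : ℝ) (P P' : Fin k → List E) :
      (1 + β) * (I.toward target).D < total (I.toward target).delay P →
      (I.toward target).Improve ρ P P' →
      Step I β (.improving target ρ P) (.improving target ρ P')

/-- The cycle cancellation algorithm, modified so as to improve whichever of cost and delay has
the worse ratio after the basic algorithm. -/
def twoSided (β : ℝ) (V E : Type*) [Fintype V] [Fintype E] [DecidableEq E] (k : ℕ)
    (I : Problem V E k) : Procedure (Fin k → List E) where
  State := State E k
  start := .start
  Step := Step I β
  output
    | .done P => some P
    | _ => none

/-- `A` is a bifactor `(a, b)`-approximation: on every instance that has a solution it computes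
`k` disjoint `st`-paths of delay sum at most `a * D` and cost sum at most `b * C`. -/
def IsBifactorApproximation.{u, v, w}
    (A : ∀ (V : Type u) (E : Type v) [Fintype V] [Fintype E] [DecidableEq E] (k : ℕ),
      Problem V E k → Procedure.{v, w} (Fin k → List E)) (a b : ℝ) : Prop :=
  ∀ (V : Type u) (E : Type v) [Fintype V] [Fintype E] [DecidableEq E] (k : ℕ)
    (I : Problem V E k), I.Feasible →
      (A V E k I).Computes fun P =>
        I.DisjointPaths P ∧ total I.delay P ≤ a * I.D ∧ total I.cost P ≤ b * I.C

end KBCP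

/-! Put `x = d(P)/D - 1` and `y = c(P)/C`, after exchanging cost and delay if necessary. The whole
analysis is that `y + log x ≤ 0` holds throughout the improving phase, as long as `x > 0`. Initially
the mixed objective is at most that of a feasible solution, so `y + x ≤ 1`, and `log x ≤ x - 1`
gives the claim. For an iteration, the difference between `P` and a feasible solution is a
circulation in the residual graph. It splits into cycles, each meeting the cost bound, with total
delay at most `D - d(P)` and total cost at most `C`. The cycle `O` of best ratio is at least as good
as this average: with `γ = c(O)/C` and `δ = d(O)/D`, `x * γ ≤ -δ` (`BestCycle.mul_le`). Hence the
new excess is at most `x * (1 - γ)`, its logarithm drops by at least `γ`, and `y` grows by at most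
`γ` (`Invariant.improve`). An iteration is performed only if `x > β`, so that `y < -log β = β`
before it. As `γ ≤ 1`, the cost ratio afterwards is below `1 + β`. Equality of the two guarantees is
the equation `β + log β = 0`. A positive reversal cost is harmless: for integral data it is too
small to alter a strict comparison of ratios (`BestCycle.zero`). Termination holds because the delay
strictly decreases among finitely many solutions. -/

namespace KBCP

/-! ### Walks, their weights, and shortening to paths. -/

section Walks

variable {V E : Type*} {src tgt : E → V}

theorem weight_nil (w : E → ℝ) : weight w [] = 0 := rfl

theorem weight_cons (w : E → ℝ) (e : E) (p : List E) : weight w (e :: p) = w e + weight w p := by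
  simp [weight]

theorem weight_eq_sum [DecidableEq E] (w : E → ℝ) {p : List E} (hp : p.Nodup) :
    weight w p = ∑ e ∈ p.toFinset, w e :=
  (List.sum_toFinset w hp).symm

theorem weight_nonneg {w : E → ℝ} (hw : ∀ e, 0 ≤ w e) (p : List E) : 0 ≤ weight w p := by
  induction p with
  | nil => exact le_rfl
  | cons e p ih => rw [weight_cons]; exact add_nonneg (hw e) ih

theorem exists_int_weight {w : E → ℝ} (hw : ∀ e, ∃ z : ℤ, w e = z) (p : List E) :
    ∃ z : ℤ, weight w p = z := by
  induction p with
  | nil => exact ⟨0, by simp [weight_nil]⟩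
  | cons e p ih =>
    obtain ⟨a, ha⟩ := hw e
    obtain ⟨b, hb⟩ := ih
    exact ⟨a + b, by rw [weight_cons, ha, hb]; push_cast; rfl⟩

theorem IsWalk.weight_sub (f : V → ℝ) {u v : V} {p : List E} (h : IsWalk src tgt u p v) :
    weight (fun e => f (src e) - f (tgt e)) p = f u - f v := by
  induction p generalizing u with
  | nil =>
    obtain rfl : u = v := h
    simp [weight_nil]
  | cons e p ih =>
    obtain ⟨rfl, h⟩ := h
    rw [weight_cons, ih h]
    ring

theorem IsWalk.concat {u v : V} {p : List E} {e : E} (h : IsWalk src tgt u p v)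
    (he : src e = v) : IsWalk src tgt u (p ++ [e]) (tgt e) := by
  induction p generalizing u with
  | nil =>
    obtain rfl : u = v := h
    exact ⟨he, rfl⟩
  | cons e' p ih => exact ⟨h.1, ih h.2⟩

theorem IsPath.nodup {u v : V} {p : List E} (h : IsPath src tgt u p v) : p.Nodup :=
  List.Nodup.of_map tgt (List.nodup_cons.1 h.2).2

theorem IsCycle.nodup {p : List E} (h : IsCycle src tgt p) : p.Nodup :=
  List.Nodup.of_map tgt h.2.2

theorem IsPath.exists_suffix {u v x : V} {p : List E} (h : IsPath src tgt u p v)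
    (hx : x ∈ u :: p.map tgt) : ∃ q, IsPath src tgt x q v ∧ q ⊆ p := by
  induction p generalizing u with
  | nil =>
    obtain rfl : x = u := by simpa using hx
    exact ⟨[], h, List.Subset.refl _⟩
  | cons e p ih =>
    rcases List.mem_cons.1 hx with rfl | hx
    · exact ⟨e :: p, h, List.Subset.refl _⟩
    · obtain ⟨q, hq, hqp⟩ := ih (u := tgt e) ⟨h.1.2, (List.nodup_cons.1 h.2).2⟩ hx
      exact ⟨q, hq, List.subset_cons_of_subset e hqp⟩

theorem IsWalk.exists_isPath {u v : V} {p : List E} (h : IsWalk src tgt u p v) :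
    ∃ q, IsPath src tgt u q v ∧ q ⊆ p := by
  induction p generalizing u with
  | nil => exact ⟨[], ⟨h, by simp⟩, List.Subset.refl _⟩
  | cons e p ih =>
    obtain ⟨q, hq, hqp⟩ := ih h.2
    by_cases hu : u ∈ tgt e :: q.map tgt
    · obtain ⟨r, hr, hrq⟩ := hq.exists_suffix hu
      exact ⟨r, hr, List.subset_cons_of_subset e (List.Subset.trans hrq hqp)⟩
    · exact ⟨e :: q, ⟨⟨h.1, hq.1⟩, List.nodup_cons.2 ⟨hu, hq.2⟩⟩, List.cons_subset_cons e hqp⟩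

end Walks

/-! ### Unit flows on edge sets and their decomposition into paths and cycles. -/

section Flows

variable {V E : Type*} {src tgt : E → V}

/-- The edges in `F`, each carrying one unit, form a flow of value `a` from `u` to `v`. This is
expressed by testing against all potentials. -/
def IsFlow (src tgt : E → V) (F : Finset E) (a : ℝ) (u v : V) : Prop :=
  ∀ f : V → ℝ, ∑ e ∈ F, (f (src e) - f (tgt e)) = a * (f u - f v)

theorem IsFlow.exists_isPath {F : Finset E} {a : ℝ} {u v : V} (h : IsFlow src tgt F a u v)
    (ha : 0 < a) : ∃ p, IsPath src tgt u p v ∧ ∀ e ∈ p, e ∈ F := by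
  classical
  let R : Set V := {x | ∃ p, IsWalk src tgt u p x ∧ ∀ e ∈ p, e ∈ F}
  suffices hv : v ∈ R by
    obtain ⟨p, hp, hpF⟩ := hv
    obtain ⟨q, hq, hqp⟩ := hp.exists_isPath
    exact ⟨q, hq, fun e he => hpF e (hqp he)⟩
  by_contra hv
  have hu : u ∈ R := ⟨[], rfl, by simp⟩
  -- Cut argument: no edge of `F` leaves the reachable set `R`, so its indicator as potential makes
  -- the sum nonpositive, while separating `u` from `v` would make it `a > 0`.
  have hsum := h fun x => if x ∈ R then 1 else 0
  have hle : ∑ e ∈ F, ((if src e ∈ R then (1 : ℝ) else 0) - if tgt e ∈ R then 1 else 0) ≤ 0 := by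
    refine Finset.sum_nonpos fun e he => ?_
    by_cases hs : src e ∈ R
    · have ht : tgt e ∈ R := by
        obtain ⟨p, hp, hpF⟩ := hs
        refine ⟨p ++ [e], hp.concat rfl, fun e' he' => ?_⟩
        rcases List.mem_append.1 he' with h' | h'
        · exact hpF e' h'
        · rwa [List.mem_singleton.1 h']
      simp [hs, ht]
    · rw [if_neg hs]
      split_ifs <;> norm_num
  simp only [hu, hv, if_true, if_false] at hsum
  linarith

variable [DecidableEq E]

theorem IsWalk.isFlow {u v : V} {p : List E} (h : IsWalk src tgt u p v) (hp : p.Nodup) :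
    IsFlow src tgt p.toFinset 1 u v := fun f => by
  rw [← weight_eq_sum _ hp, h.weight_sub, one_mul]

theorem IsFlow.exists_isCycle {F : Finset E} {u v : V} (h : IsFlow src tgt F 0 u v)
    (hF : F.Nonempty) : ∃ p, IsCycle src tgt p ∧ p.toFinset ⊆ F := by
  obtain ⟨e, he⟩ := hF
  -- Deleting an edge from a circulation leaves a unit flow from its head to its tail; a path in
  -- that flow closes up with the edge to a cycle.
  have hflow : IsFlow src tgt (F.erase e) 1 (tgt e) (src e) := fun f => by
    have := h f
    rw [← Finset.add_sum_erase F _ he] at this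
    linarith
  obtain ⟨p, hp, hpF⟩ := hflow.exists_isPath one_pos
  refine ⟨e :: p, ⟨List.cons_ne_nil _ _, ⟨src e, rfl, hp.1⟩, hp.2⟩, fun e' he' => ?_⟩
  rcases List.mem_cons.1 (List.mem_toFinset.1 he') with rfl | h'
  · exact he
  · exact Finset.mem_of_mem_erase (hpF e' h')

/-- A weight that is nonnegative on every cycle is nonnegative on every circulation. -/
theorem IsFlow.sum_nonneg_of_isCycle {u v : V} (w : E → ℝ) {F : Finset E}
    (h : IsFlow src tgt F 0 u v)
    (hw : ∀ p, IsCycle src tgt p → p.toFinset ⊆ F → 0 ≤ weight w p) : 0 ≤ ∑ e ∈ F, w e := by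
  induction F using Finset.strongInduction with
  | H F ih =>
    rcases F.eq_empty_or_nonempty with rfl | hF
    · simp
    obtain ⟨p, hp, hpF⟩ := h.exists_isCycle hF
    have hne : p.toFinset.Nonempty := List.toFinset_nonempty_iff p |>.2 hp.1
    have hflow : IsFlow src tgt (F \ p.toFinset) 0 u v := fun f => by
      obtain ⟨x, hx⟩ := hp.2.1
      have h₁ := h f
      have h₂ := hx.isFlow hp.nodup f
      rw [← Finset.sum_sdiff hpF] at h₁
      linarith
    have h₁ := ih _ (Finset.sdiff_ssubset hpF hne) hflow
      fun q hq hqF => hw q hq (hqF.trans Finset.sdiff_subset)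
    have h₂ := hw p hp hpF
    rw [weight_eq_sum w hp.nodup] at h₂
    rw [← Finset.sum_sdiff hpF]
    linarith

/-- A flow of value `k` contains `k` disjoint paths. -/
theorem IsFlow.exists_disjoint_paths {u v : V} (k : ℕ) {F : Finset E}
    (h : IsFlow src tgt F k u v) :
    ∃ P : Fin k → List E, (∀ i, IsPath src tgt u (P i) v) ∧
      (Pairwise fun i j => (P i).Disjoint (P j)) ∧ ∀ i, ∀ e ∈ P i, e ∈ F := by
  induction k generalizing F with
  | zero => exact ⟨fun _ => [], fun i => i.elim0, fun i => i.elim0, fun i => i.elim0⟩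
  | succ k ih =>
    obtain ⟨p, hp, hpF⟩ := h.exists_isPath (by positivity)
    have hpF' : p.toFinset ⊆ F := fun e he => hpF e (List.mem_toFinset.1 he)
    have hflow : IsFlow src tgt (F \ p.toFinset) k u v := fun f => by
      have h₁ := h f
      have h₂ := hp.1.isFlow hp.nodup f
      rw [← Finset.sum_sdiff hpF'] at h₁
      push_cast at h₁
      linarith
    obtain ⟨P, hP, hd, hPF⟩ := ih hflow
    have hdis : ∀ i, p.Disjoint (P i) := fun i e he he' => by
      have := hPF i e he'
      simp [he] at this
    refine ⟨Fin.cons p P, ?_, ?_, ?_⟩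
    · refine Fin.cases ?_ fun i => ?_
      · simpa using hp
      · simpa using hP i
    · intro i j hij
      induction i using Fin.cases with
      | zero =>
        induction j using Fin.cases with
        | zero => exact absurd rfl hij
        | succ j => simpa using hdis j
      | succ i =>
        induction j using Fin.cases with
        | zero => simpa using (hdis i).symm
        | succ j => simpa using hd fun h => hij (congrArg Fin.succ h)
    · refine Fin.cases ?_ fun i => ?_
      · simpa using hpF
      · simpa using fun e he => Finset.sdiff_subset (hPF i e he)

theorem sum_symmDiff_eq (g : E → ℝ) (F O : Finset E) :
    ∑ e ∈ symmDiff F O, g e = ∑ e ∈ F, g e + ∑ e ∈ O, if e ∈ F then -g e else g e := by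
  have h₁ : ∑ e ∈ symmDiff F O, g e = ∑ e ∈ F \ O, g e + ∑ e ∈ O \ F, g e := by
    rw [symmDiff_def, Finset.sup_eq_union, Finset.sum_union disjoint_sdiff_sdiff]
  have h₂ : ∑ e ∈ O, (if e ∈ F then -g e else g e)
      = ∑ e ∈ O \ F, g e - ∑ e ∈ F ∩ O, g e := by
    rw [Finset.sum_ite, Finset.filter_mem_eq_inter, Finset.filter_notMem_eq_sdiff,
      Finset.sum_neg_distrib, Finset.inter_comm]
    ring
  have h₃ : ∑ e ∈ F ∩ O, g e + ∑ e ∈ F \ O, g e = ∑ e ∈ F, g e :=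
    Finset.sum_inter_add_sum_sdiff F O g
  linarith

/-- Cancelling `symmDiff F Q` against `F` yields `Q`. Taking `g` to be a potential difference or the
delay gives the circulation property and the residual delay of the difference. -/
theorem sum_symmDiff_residual (g : E → ℝ) (F Q : Finset E) :
    ∑ e ∈ symmDiff F Q, (if e ∈ F then -g e else g e) = ∑ e ∈ Q, g e - ∑ e ∈ F, g e := by
  have h := sum_symmDiff_eq g F (symmDiff F Q)
  rw [symmDiff_symmDiff_cancel_left] at h
  linarith

end Flows

/-! ### Solutions, exchange of cost and delay, and the logarithmic potential. -/

namespace Problem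

variable {V E : Type*} {k : ℕ} {I : Problem V E k}

theorem DisjointPaths.total_eq_sum [DecidableEq E] {P : Fin k → List E} (h : I.DisjointPaths P)
    (w : E → ℝ) : total w P = ∑ e ∈ edges P, w e := by
  rw [edges, Finset.sum_biUnion]
  · exact Finset.sum_congr rfl fun i _ => weight_eq_sum w (h.1 i).nodup
  · intro i _ j _ hij
    exact List.disjoint_toFinset_iff_disjoint.2 (h.2 hij)

theorem DisjointPaths.isFlow [DecidableEq E] {P : Fin k → List E} (h : I.DisjointPaths P) :
    IsFlow I.src I.tgt (edges P) k I.s I.t := fun f => by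
  rw [← h.total_eq_sum, total, Finset.sum_congr rfl fun i _ => (h.1 i).1.weight_sub f]
  simp [mul_sub]

theorem finite_setOf_disjointPaths [Finite E] (I : Problem V E k) :
    {P | I.DisjointPaths P}.Finite := by
  classical
  have := Fintype.ofFinite E
  have h : {l : List E | l.Nodup}.Finite :=
    (List.finite_length_le E (Fintype.card E)).subset fun l hl => List.Nodup.length_le_card hl
  exact (Set.Finite.pi' fun _ : Fin k => h).subset fun P hP i => (hP.1 i).nodup

theorem Feasible.exists_basicOutput [Finite E] (h : I.Feasible) : ∃ P, I.BasicOutput P := by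
  obtain ⟨Q, hQ, -⟩ := h
  exact Set.exists_min_image _ (total fun e => I.cost e / I.C + I.delay e / I.D)
    I.finite_setOf_disjointPaths ⟨Q, hQ⟩

theorem ReverseCost.nonneg [Fintype V] [Fintype E] {ρ : ℝ} (h : I.ReverseCost ρ) : 0 ≤ ρ := by
  rcases h with rfl | ⟨-, h, -⟩
  exacts [le_rfl, h.le]

theorem Feasible.swap {I : Problem V E k} (h : I.Feasible) : I.swap.Feasible := by
  obtain ⟨P, hP, hC, hD⟩ := h
  exact ⟨P, hP, hD, hC⟩

theorem BasicOutput.swap {I : Problem V E k} {P : Fin k → List E} (h : I.BasicOutput P) :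
    I.swap.BasicOutput P := by
  refine ⟨h.1, fun Q hQ => ?_⟩
  have := h.2 Q hQ
  simp only [add_comm (I.cost _ / I.C)] at this
  exact this

theorem Feasible.toward {I : Problem V E k} (h : I.Feasible) (target : Target) :
    (I.toward target).Feasible := by
  cases target
  exacts [h, h.swap]

theorem BasicOutput.toward {I : Problem V E k} {P : Fin k → List E} (h : I.BasicOutput P)
    (target : Target) : (I.toward target).BasicOutput P := by
  cases target
  exacts [h, h.swap]

theorem total_mixed (I : Problem V E k) (P : Fin k → List E) :
    total (fun e => I.cost e / I.C + I.delay e / I.D) P =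
      total I.cost P / I.C + total I.delay P / I.D := by
  have h : ∀ p : List E, weight (fun e => I.cost e / I.C + I.delay e / I.D) p =
      weight I.cost p / I.C + weight I.delay p / I.D := fun p => by
    induction p with
    | nil => simp [weight_nil]
    | cons e p ih => rw [weight_cons, weight_cons, weight_cons, ih]; ring
  simp only [total, h, Finset.sum_add_distrib, Finset.sum_div]

theorem BasicOutput.add_le_two {I : Problem V E k} {P : Fin k → List E} (h : I.BasicOutput P)
    (hI : I.Feasible) : total I.cost P / I.C + total I.delay P / I.D ≤ 2 := by
  obtain ⟨Q, hQ, hC, hD⟩ := hI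
  have hle := h.2 Q hQ
  rw [total_mixed, total_mixed] at hle
  have h₁ := (div_le_one I.C_pos).2 hC
  have h₂ := (div_le_one I.D_pos).2 hD
  linarith

/-- What the improving phase preserves: in terms of `x = d(P)/D - 1` and `y = c(P)/C`, the bounds
`x ≤ 1` and `y ≤ 1 + β`, and `y + log x ≤ 0` as long as `x` is positive. -/
structure Invariant (I : Problem V E k) (β : ℝ) (P : Fin k → List E) : Prop where
  disjointPaths : I.DisjointPaths P
  delay_le : total I.delay P / I.D - 1 ≤ 1
  cost_le : total I.cost P / I.C ≤ 1 + β
  add_log_le : 0 < total I.delay P / I.D - 1 →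
    total I.cost P / I.C + Real.log (total I.delay P / I.D - 1) ≤ 0

/-- The two ratios add up to at most `2`. Being the smaller one, the cost ratio is at most `1`; the
logarithmic bound is the tangent inequality `log x ≤ x - 1`. -/
theorem BasicOutput.invariant {I : Problem V E k} {β : ℝ} (hβ : 0 ≤ β) {P : Fin k → List E}
    (h : I.BasicOutput P) (hI : I.Feasible)
    (hle : total I.cost P / I.C ≤ total I.delay P / I.D) : I.Invariant β P := by
  have h2 := h.add_le_two hI
  have h0 : 0 ≤ total I.cost P / I.C :=
    div_nonneg (Finset.sum_nonneg fun i _ => weight_nonneg I.cost_nonneg (P i)) I.C_pos.le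
  refine ⟨h.1, by linarith, by linarith, fun hx => ?_⟩
  linarith [Real.log_le_sub_one_of_pos hx]

/-- The required properties of the returned paths. -/
def GoodOutput (I : Problem V E k) (β : ℝ) (P : Fin k → List E) : Prop :=
  I.DisjointPaths P ∧ total I.delay P ≤ (1 + β) * I.D ∧ total I.cost P ≤ (1 + β) * I.C

theorem Invariant.goodOutput {β : ℝ} {target : Target} {P : Fin k → List E}
    (h : (I.toward target).Invariant β P)
    (hD : total (I.toward target).delay P ≤ (1 + β) * (I.toward target).D) :
    I.GoodOutput β P := by
  have hC := (div_le_iff₀ (I.toward target).C_pos).1 h.cost_le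
  cases target
  exacts [⟨h.disjointPaths, hD, hC⟩, ⟨h.disjointPaths, hC, hD⟩]

/-! ### The residual graph: existence and quality of best cycles. -/

variable [DecidableEq E]

theorem residual_sub (f : V → ℝ) (F : Finset E) (e : E) :
    f (I.resSrc F e) - f (I.resTgt F e) =
      if e ∈ F then -(f (I.src e) - f (I.tgt e)) else f (I.src e) - f (I.tgt e) := by
  unfold resSrc resTgt
  split_ifs <;> ring

theorem resCost_nonneg {ρ : ℝ} (hρ : 0 ≤ ρ) (F : Finset E) (e : E) : 0 ≤ I.resCost ρ F e := by
  unfold resCost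
  split_ifs
  exacts [hρ, I.cost_nonneg e]

/-- The difference of two solutions is a circulation in the residual graph of the first one. -/
theorem DisjointPaths.isFlow_symmDiff {P Q : Fin k → List E} (hP : I.DisjointPaths P)
    (hQ : I.DisjointPaths Q) :
    IsFlow (I.resSrc (edges P)) (I.resTgt (edges P)) (symmDiff (edges P) (edges Q)) 0 I.s I.t :=
  fun f => by
    simp only [residual_sub]
    rw [sum_symmDiff_residual fun e => f (I.src e) - f (I.tgt e), hP.isFlow f, hQ.isFlow f]
    ring

theorem DisjointPaths.sum_resDelay {P Q : Fin k → List E} (hP : I.DisjointPaths P)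
    (hQ : I.DisjointPaths Q) :
    ∑ e ∈ symmDiff (edges P) (edges Q), I.resDelay (edges P) e =
      total I.delay Q - total I.delay P := by
  rw [hP.total_eq_sum, hQ.total_eq_sum]
  exact sum_symmDiff_residual I.delay _ _

/-- Reversed edges are free here, and every other edge of the difference belongs to `Q`. -/
theorem sum_resCost_le (I : Problem V E k) (F Q : Finset E) :
    ∑ e ∈ symmDiff F Q, I.resCost 0 F e ≤ ∑ e ∈ Q, I.cost e := by
  calc ∑ e ∈ symmDiff F Q, I.resCost 0 F e
      = ∑ e ∈ symmDiff F Q with e ∉ F, I.cost e := by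
        rw [Finset.sum_filter]
        refine Finset.sum_congr rfl fun e _ => ?_
        by_cases h : e ∈ F <;> simp [resCost, h]
    _ ≤ ∑ e ∈ Q, I.cost e := by
        refine Finset.sum_le_sum_of_subset_of_nonneg (fun e he => ?_) fun e _ _ => I.cost_nonneg e
        simp only [Finset.mem_filter, Finset.mem_symmDiff] at he
        tauto

/-- Every residual cycle contained in the difference to a solution satisfies the cost bound. -/
theorem weight_resCost_le {F Q : Finset E} {O : List E} (hO : O.Nodup)
    (h : O.toFinset ⊆ symmDiff F Q) : weight (I.resCost 0 F) O ≤ ∑ e ∈ Q, I.cost e := by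
  rw [weight_eq_sum _ hO]
  exact (Finset.sum_le_sum_of_subset_of_nonneg h
    fun e _ _ => resCost_nonneg le_rfl F e).trans (I.sum_resCost_le F Q)

theorem exists_candidate {P Q : Fin k → List E} (hP : I.DisjointPaths P)
    (hQ : I.DisjointPaths Q) (hC : total I.cost Q ≤ I.C)
    (hlt : total I.delay Q < total I.delay P) : ∃ O, I.Candidate (edges P) O := by
  by_contra! hno
  have h := (hP.isFlow_symmDiff hQ).sum_nonneg_of_isCycle (I.resDelay (edges P))
    fun O hO hsub => by
      by_contra! hneg
      refine hno O ⟨hO, (weight_resCost_le hO.nodup hsub).trans ?_, hneg⟩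
      rwa [← hQ.total_eq_sum]
  rw [hP.sum_resDelay hQ] at h
  linarith

theorem exists_bestCycle [Finite E] {ρ : ℝ} (hρ : 0 ≤ ρ) {F : Finset E}
    (h : ∃ O, I.Candidate F O) : ∃ O, I.BestCycle ρ F O := by
  -- A candidate of cost `0` has ratio `-∞` and is best at once; real division would give it ratio
  -- `0`, so only the other case may minimize the quotient.
  by_cases h0 : ∃ O, I.Candidate F O ∧ weight (I.resCost ρ F) O = 0
  · obtain ⟨O, hO, hO0⟩ := h0
    refine ⟨O, hO, fun O' _ => ?_⟩
    rw [hO0, mul_zero]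
    exact mul_nonpos_of_nonpos_of_nonneg hO.2.2.le (weight_nonneg (resCost_nonneg hρ F) O')
  · push Not at h0
    have := Fintype.ofFinite E
    have hfin : {O | I.Candidate F O}.Finite :=
      (List.finite_length_le E (Fintype.card E)).subset
        fun O hO => List.Nodup.length_le_card hO.1.nodup
    obtain ⟨O, hO, hmin⟩ := Set.exists_min_image _
      (fun O => weight (I.resDelay F) O / weight (I.resCost ρ F) O) hfin h
    have hpos : ∀ O, I.Candidate F O → 0 < weight (I.resCost ρ F) O := fun O hO =>
      lt_of_le_of_ne (weight_nonneg (resCost_nonneg hρ F) O) (h0 O hO).symm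
    exact ⟨O, hO, fun O' hO' => (div_le_div_iff₀ (hpos O hO) (hpos O' hO')).1 (hmin O' hO')⟩

theorem exists_improve [Finite E] {ρ : ℝ} (hρ : 0 ≤ ρ) {P : Fin k → List E} (hI : I.Feasible)
    (hP : I.DisjointPaths P) (hD : I.D < total I.delay P) : ∃ P', I.Improve ρ P P' := by
  obtain ⟨Q, hQ, hC, hQD⟩ := hI
  obtain ⟨O, hO⟩ := exists_bestCycle hρ (exists_candidate hP hQ hC (hQD.trans_lt hD))
  have hflow : IsFlow I.src I.tgt (symmDiff (edges P) O.toFinset) k I.s I.t := fun f => by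
    obtain ⟨x, hx⟩ := hO.1.1.2.1
    have h := hx.isFlow hO.1.1.nodup f
    simp only [residual_sub] at h
    rw [sum_symmDiff_eq, hP.isFlow f, h]
    ring
  obtain ⟨P', hpath, hdis, hsub⟩ := hflow.exists_disjoint_paths
  refine ⟨P', O, hO, ⟨hpath, hdis⟩, fun e he => ?_⟩
  obtain ⟨i, -, hi⟩ := Finset.mem_biUnion.1 he
  exact hsub i e (List.mem_toFinset.1 hi)

theorem sum_delay_symmDiff {F : Finset E} {O : List E} (hO : O.Nodup) :
    ∑ e ∈ symmDiff F O.toFinset, I.delay e = ∑ e ∈ F, I.delay e + weight (I.resDelay F) O := by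
  rw [sum_symmDiff_eq, weight_eq_sum _ hO]
  rfl

theorem total_delay_le {P P' : Fin k → List E} {O : List E} (hP : I.DisjointPaths P)
    (hP' : I.DisjointPaths P') (hO : O.Nodup) (hsub : edges P' ⊆ symmDiff (edges P) O.toFinset) :
    total I.delay P' ≤ total I.delay P + weight (I.resDelay (edges P)) O := by
  rw [hP.total_eq_sum, hP'.total_eq_sum, ← sum_delay_symmDiff hO]
  exact Finset.sum_le_sum_of_subset_of_nonneg hsub fun e _ _ => I.delay_nonneg e

theorem total_cost_le {P P' : Fin k → List E} {O : List E} (hP : I.DisjointPaths P)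
    (hP' : I.DisjointPaths P') (hO : O.Nodup) (hsub : edges P' ⊆ symmDiff (edges P) O.toFinset) :
    total I.cost P' ≤ total I.cost P + weight (I.resCost 0 (edges P)) O := by
  rw [hP.total_eq_sum, hP'.total_eq_sum, weight_eq_sum _ hO]
  refine (Finset.sum_le_sum_of_subset_of_nonneg hsub fun e _ _ => I.cost_nonneg e).trans ?_
  rw [sum_symmDiff_eq]
  -- Edges removed from `P` refund their cost, whereas the residual cost counts them as `0`.
  gcongr with e
  unfold resCost
  split_ifs
  · linarith [I.cost_nonneg e]
  · exact le_rfl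

theorem Improve.total_delay_lt {ρ : ℝ} {P P' : Fin k → List E} (hP : I.DisjointPaths P)
    (h : I.Improve ρ P P') : total I.delay P' < total I.delay P := by
  obtain ⟨O, hO, hP', hsub⟩ := h
  linarith [total_delay_le hP hP' hO.1.1.nodup hsub, hO.1.2.2]

/-- A best cycle is at least as good as the difference to a feasible solution. -/
theorem BestCycle.mul_le {P : Fin k → List E} {O : List E} (hO : I.BestCycle 0 (edges P) O)
    (hI : I.Feasible) (hP : I.DisjointPaths P) :
    (total I.delay P - I.D) * weight (I.resCost 0 (edges P)) O ≤
      -weight (I.resDelay (edges P)) O * I.C := by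
  obtain ⟨Q, hQ, hC, hD⟩ := hI
  set c := weight (I.resCost 0 (edges P)) O
  set d := weight (I.resDelay (edges P)) O
  have hc : 0 ≤ c := weight_nonneg (resCost_nonneg le_rfl _) O
  have hd : d < 0 := hO.1.2.2
  -- The linear weight `d(e) * c - d * c(e)` encodes the ratio comparison with `O`. It is
  -- nonnegative on cycles of negative delay by the choice of `O` and on all others by signs, hence
  -- on the whole circulation.
  have h := (hP.isFlow_symmDiff hQ).sum_nonneg_of_isCycle
    (fun e => I.resDelay (edges P) e * c - d * I.resCost 0 (edges P) e) fun O' hO' hsub => by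
      have hw : weight (fun e => I.resDelay (edges P) e * c - d * I.resCost 0 (edges P) e) O' =
          weight (I.resDelay (edges P)) O' * c - d * weight (I.resCost 0 (edges P)) O' := by
        simp only [weight_eq_sum _ hO'.nodup, Finset.sum_sub_distrib, Finset.sum_mul,
          Finset.mul_sum]
      rw [hw, sub_nonneg]
      rcases lt_or_ge (weight (I.resDelay (edges P)) O') 0 with hneg | hpos
      · refine hO.2 O' ⟨hO', (weight_resCost_le hO'.nodup hsub).trans ?_, hneg⟩
        rwa [← hQ.total_eq_sum]
      · exact (mul_nonpos_of_nonpos_of_nonneg hd.le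
          (weight_nonneg (resCost_nonneg le_rfl _) O')).trans (mul_nonneg hpos hc)
  rw [Finset.sum_sub_distrib, ← Finset.sum_mul, ← Finset.mul_sum, hP.sum_resDelay hQ] at h
  have hcost := I.sum_resCost_le (edges P) (edges Q)
  rw [← hQ.total_eq_sum] at hcost
  have h₁ := mul_le_mul_of_nonneg_left (hcost.trans hC) (neg_nonneg.2 hd.le)
  have h₂ := mul_le_mul_of_nonneg_right hD hc
  linarith

/-! ### Positive reversal costs for integral data. -/

theorem weight_resCost_mono {ρ : ℝ} (hρ : 0 ≤ ρ) (F : Finset E) (O : List E) :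
    weight (I.resCost 0 F) O ≤ weight (I.resCost ρ F) O := by
  induction O with
  | nil => exact le_rfl
  | cons e O ih =>
    rw [weight_cons, weight_cons]
    refine add_le_add ?_ ih
    unfold resCost
    split_ifs
    exacts [hρ, le_rfl]

theorem weight_resCost_le_add {ρ : ℝ} (hρ : 0 ≤ ρ) (F : Finset E) (O : List E) :
    weight (I.resCost ρ F) O ≤ weight (I.resCost 0 F) O + ρ * O.length := by
  induction O with
  | nil => simp [weight_nil]
  | cons e O ih =>
    have : I.resCost ρ F e ≤ I.resCost 0 F e + ρ := by
      unfold resCost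
      split_ifs <;> linarith
    rw [weight_cons, weight_cons, List.length_cons]
    push_cast
    linarith

/-- Since `s ≠ t`, every path has an edge, so with a single edge available all solutions use the
same edges. The bound `2 ≤ m` absorbs the factor in `-d(O) ≤ 2 * D` when `BestCycle.zero` uses `ρ <
1/(mnD)`. -/
theorem two_le_card [Fintype E] {P Q : Fin k → List E} (hP : I.DisjointPaths P)
    (hQ : I.DisjointPaths Q) (hlt : total I.delay Q < total I.delay P) :
    2 ≤ Fintype.card E := by
  by_contra! hcard
  have hsub : Subsingleton E := Fintype.card_le_one_iff_subsingleton.1 (by omega)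
  have hne : ∀ {R : Fin k → List E}, I.DisjointPaths R → ∀ i, R i ≠ [] := fun hR i h0 => by
    have := (hR.1 i).1
    rw [h0] at this
    exact I.s_ne_t this
  have hle : total I.delay P ≤ total I.delay Q := by
    rw [hP.total_eq_sum, hQ.total_eq_sum]
    refine Finset.sum_le_sum_of_subset_of_nonneg (fun e he => ?_) fun e _ _ => I.delay_nonneg e
    obtain ⟨i, -, -⟩ := Finset.mem_biUnion.1 he
    obtain ⟨e', he'⟩ := List.exists_mem_of_ne_nil _ (hne hQ i)
    rw [Subsingleton.elim e e']
    exact Finset.mem_biUnion.2 ⟨i, Finset.mem_univ i, List.mem_toFinset.2 he'⟩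
  linarith

/-- A permitted positive cost of the reversed edges only breaks ties between cycles. -/
theorem BestCycle.zero [Fintype V] [Fintype E] {ρ : ℝ} {P : Fin k → List E} {O : List E}
    (hρ : I.ReverseCost ρ) (hO : I.BestCycle ρ (edges P) O) (hI : I.Feasible)
    (hP : I.DisjointPaths P) (hlow : I.D < total I.delay P) (hup : total I.delay P ≤ 2 * I.D) :
    I.BestCycle 0 (edges P) O := by
  have hρ0 := hρ.nonneg
  rcases hρ with rfl | ⟨⟨hcost, hdelay, -, -⟩, hρpos, hρlt⟩
  · exact hO
  refine ⟨hO.1, fun O' hO' => ?_⟩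
  obtain ⟨Q, hQ, -, hQD⟩ := hI
  have hcard : (2 : ℝ) ≤ Fintype.card E := by
    exact_mod_cast two_le_card hP hQ (hQD.trans_lt hlow)
  have hrc : ∀ e, ∃ z : ℤ, I.resCost 0 (edges P) e = z := fun e => by
    unfold resCost
    split_ifs
    exacts [⟨0, by simp⟩, hcost e]
  have hrd : ∀ e, ∃ z : ℤ, I.resDelay (edges P) e = z := fun e => by
    obtain ⟨z, hz⟩ := hdelay e
    unfold resDelay
    split_ifs
    exacts [⟨-z, by simp [hz]⟩, ⟨z, hz⟩]
  have hlen : (O'.length : ℝ) ≤ Fintype.card V := by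
    have := List.Nodup.length_le_card hO'.1.2.2
    rw [List.length_map] at this
    exact_mod_cast this
  -- The edges left after cancelling `O` have nonnegative total delay, so `O` cannot save more than
  -- `d(P)`.
  have hdO : -weight (I.resDelay (edges P)) O ≤ 2 * I.D := by
    have h₁ := sum_delay_symmDiff (I := I) (F := edges P) hO.1.1.nodup
    have h₂ : 0 ≤ ∑ e ∈ symmDiff (edges P) O.toFinset, I.delay e :=
      Finset.sum_nonneg fun e _ => I.delay_nonneg e
    rw [← hP.total_eq_sum] at h₁
    linarith
  have hsmall : -weight (I.resDelay (edges P)) O * (ρ * O'.length) < 1 := by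
    have hDpos := I.D_pos
    calc -weight (I.resDelay (edges P)) O * (ρ * O'.length)
        ≤ (Fintype.card E * I.D) * (ρ * Fintype.card V) := by
          refine mul_le_mul (hdO.trans ?_) ?_ (by positivity) (by positivity)
          · exact mul_le_mul_of_nonneg_right hcard hDpos.le
          · exact mul_le_mul_of_nonneg_left hlen hρ0
      _ = ρ * (Fintype.card E * Fintype.card V * I.D) := by ring
      _ < 1 := hρlt
  have hbest := hO.2 O' hO'
  have h₁ := mul_le_mul_of_nonneg_left (weight_resCost_le_add (I := I) hρ0 (edges P) O')
    (neg_nonneg.2 hO.1.2.2.le)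
  have h₂ := mul_le_mul_of_nonneg_left (weight_resCost_mono (I := I) hρ0 (edges P) O)
    (neg_nonneg.2 hO'.2.2.le)
  -- The reversal cost perturbs the cross-multiplied comparison by less than `1`. Both sides are
  -- integers, so the inequality survives with `ρ = 0`.
  have hlt : weight (I.resDelay (edges P)) O * weight (I.resCost 0 (edges P)) O' <
      weight (I.resDelay (edges P)) O' * weight (I.resCost 0 (edges P)) O + 1 := by
    linarith
  obtain ⟨a, ha⟩ := exists_int_weight hrd O
  obtain ⟨b, hb⟩ := exists_int_weight hrc O'
  obtain ⟨a', ha'⟩ := exists_int_weight hrd O'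
  obtain ⟨b', hb'⟩ := exists_int_weight hrc O
  rw [ha, hb, ha', hb'] at hlt ⊢
  norm_cast at hlt ⊢
  exact Int.lt_add_one_iff.1 hlt

/-- The heart of the analysis: the logarithm of the excess delay pays for the cost of the cycle. -/
theorem Invariant.improve [Fintype V] [Fintype E] {I : Problem V E k} {β ρ : ℝ}
    {P P' : Fin k → List E} (hβ : 0 < β) (hlog : β + Real.log β = 0) (h : I.Invariant β P)
    (hI : I.Feasible) (hρ : I.ReverseCost ρ) (hD : (1 + β) * I.D < total I.delay P)
    (hP' : I.Improve ρ P P') : I.Invariant β P' := by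
  have hDpos := I.D_pos
  have hCpos := I.C_pos
  obtain ⟨O, hO, hdis, hsub⟩ := hP'
  have hup : total I.delay P ≤ 2 * I.D := (div_le_iff₀ hDpos).1 (by linarith [h.delay_le])
  have hlow : I.D < total I.delay P := by nlinarith
  have hbest := (hO.zero hρ hI h.disjointPaths hlow hup).mul_le hI h.disjointPaths
  have hd := total_delay_le h.disjointPaths hdis hO.1.1.nodup hsub
  have hc := total_cost_le h.disjointPaths hdis hO.1.1.nodup hsub
  have hγ := (div_le_one hCpos).2 hO.1.2.1
  have hδ := div_neg_of_neg_of_pos hO.1.2.2 hDpos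
  have hx : β < total I.delay P / I.D - 1 := by
    have := (lt_div_iff₀ hDpos).2 hD
    linarith
  have hx' := div_le_div_of_nonneg_right hd hDpos.le
  have hy' := div_le_div_of_nonneg_right hc hCpos.le
  have hprod : (total I.delay P / I.D - 1) * (weight (I.resCost 0 (edges P)) O / I.C) ≤
      -(weight (I.resDelay (edges P)) O / I.D) := by
    have := div_le_div_of_nonneg_right hbest (mul_pos hDpos hCpos).le
    calc _ = (total I.delay P - I.D) * weight (I.resCost 0 (edges P)) O / (I.D * I.C) := by
          field_simp
      _ ≤ _ := this
      _ = _ := by field_simp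
  rw [add_div] at hx' hy'
  have hxle := h.delay_le
  have hpot := h.add_log_le (hβ.trans hx)
  generalize total I.delay P / I.D = x at *
  generalize total I.cost P / I.C = y at *
  generalize weight (I.resCost 0 (edges P)) O / I.C = γ at *
  generalize weight (I.resDelay (edges P)) O / I.D = δ at *
  -- Here `x` is the delay ratio itself, so the excess is `x - 1`. From `log β < log (x - 1)` it
  -- follows that `y < -log β = β`, and the cycle adds `γ ≤ 1`.
  have hlogx := Real.log_lt_log hβ hx
  refine ⟨hdis, by linarith, by linarith, fun hpos => ?_⟩
  have hxpos : 0 < x - 1 := hβ.trans hx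
  -- With `r` the quotient of the new excess by the old, `log r ≤ r - 1 ≤ -γ`, which offsets the
  -- increase of `y`.
  have h₁ := Real.log_le_sub_one_of_pos (div_pos hpos hxpos)
  rw [Real.log_div hpos.ne' hxpos.ne'] at h₁
  have h₂ : γ ≤ 1 - (total I.delay P' / I.D - 1) / (x - 1) := by
    rw [one_sub_div hxpos.ne', le_div_iff₀ hxpos]
    linarith
  linarith

end Problem

/-! ### Termination, progress and correctness of the procedure. -/

section Algorithm

variable {V E : Type*} [Fintype V] [Fintype E] [DecidableEq E] {k : ℕ} {I : Problem V E k} {β : ℝ}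

/-- The invariant of the whole algorithm. -/
def State.Valid (I : Problem V E k) (β : ℝ) : State E k → Prop
  | .start => True
  | .improving target ρ P => (I.toward target).ReverseCost ρ ∧ (I.toward target).Invariant β P
  | .done P => I.GoodOutput β P

theorem Step.valid (hβ : 0 < β) (hlog : β + Real.log β = 0) (hI : I.Feasible)
    {σ σ' : State E k} (h : Step I β σ σ') (hσ : σ.Valid I β) : σ'.Valid I β := by
  cases h with
  | init target ρ P hP hle hρ =>
    exact ⟨hρ, (hP.toward target).invariant hβ.le (hI.toward target) hle⟩
  | finish target ρ P hD => exact hσ.2.goodOutput hD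
  | improve target ρ P P' hD hP' =>
    exact ⟨hσ.1, hσ.2.improve hβ hlog (hI.toward target) hσ.1 hD hP'⟩

theorem acc_done (P : Fin k → List E) : Acc (fun σ' σ => Step I β σ σ') (.done P) :=
  ⟨_, fun _ h => nomatch h⟩

/-- Only finitely many solutions exist and each iteration strictly lowers the delay, so no infinite
run is possible. -/
theorem acc_improving (target : Target) (ρ : ℝ) {P : Fin k → List E}
    (hP : (I.toward target).DisjointPaths P) :
    Acc (fun σ' σ => Step I β σ σ') (.improving target ρ P) := by
  have hwf := (I.toward target).finite_setOf_disjointPaths.wellFoundedOn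
    (r := fun P' P => total (I.toward target).delay P' < total (I.toward target).delay P)
  refine hwf.induction (P := fun P => Acc (fun σ' σ => Step I β σ σ') (.improving target ρ P))
    hP fun P hP ih => ⟨_, fun σ' h => ?_⟩
  cases h with
  | finish => exact acc_done P
  | improve _ _ _ P' _ hP' =>
    have hlt := hP'.total_delay_lt hP
    obtain ⟨O, -, hdis, -⟩ := hP'
    exact ih P' hdis hlt

theorem acc_start : Acc (fun σ' σ => Step I β σ σ') .start := by
  refine ⟨_, fun σ' h => ?_⟩
  cases h with
  | init target ρ P hP => exact acc_improving target ρ (hP.toward target).1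

theorem State.Valid.progress (hβ : 0 < β) (hI : I.Feasible) {σ : State E k}
    (hσ : σ.Valid I β) : (∃ σ', Step I β σ σ') ∨ ∃ P, σ = .done P := by
  cases σ with
  | start =>
    left
    obtain ⟨P, hP⟩ := hI.exists_basicOutput
    rcases le_total (total I.cost P / I.C) (total I.delay P / I.D) with h | h
    · exact ⟨_, .init .delay 0 P hP h (Or.inl rfl)⟩
    · exact ⟨_, .init .cost 0 P hP h (Or.inl rfl)⟩
  | improving target ρ P =>
    left
    rcases le_or_gt (total (I.toward target).delay P) ((1 + β) * (I.toward target).D) with h | h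
    · exact ⟨_, .finish target ρ P h⟩
    · have hDpos := (I.toward target).D_pos
      obtain ⟨P', hP'⟩ := Problem.exists_improve hσ.1.nonneg (hI.toward target)
        hσ.2.disjointPaths (by nlinarith)
      exact ⟨_, .improve target ρ P P' h hP'⟩
  | done P => exact Or.inr ⟨P, rfl⟩

theorem twoSided_computes (hβ : 0 < β) (hlog : β + Real.log β = 0) (hI : I.Feasible) :
    (twoSided β V E k I).Computes (I.GoodOutput β) := by
  refine ⟨acc_start, fun σ hσ => ?_⟩
  have hvalid : σ.Valid I β := by
    induction hσ with
    | refl => trivial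
    | tail _ h ih => exact h.valid hβ hlog hI ih
  refine ⟨?_, fun P hP => ?_⟩
  · rcases hvalid.progress hβ hI with h | ⟨P, rfl⟩
    exacts [Or.inl h, Or.inr rfl]
  · cases σ with
    | start => cases hP
    | improving => cases hP
    | done P' =>
      cases hP
      exact hvalid

end Algorithm

/-! ### The root of `β + log β = 0` and its numerical value. -/

section Parameter

theorem strictMonoOn_add_log : StrictMonoOn (fun x : ℝ => x + Real.log x) (Set.Ioi 0) :=
  fun _ hx _ _ hxy => add_lt_add hxy (Real.log_lt_log hx hxy)

/-- The endpoints `0.567 ± 0.0005` bracket the root. Exponentiation turns each sign into a bound on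
`exp`, which six Taylor terms settle. -/
theorem add_log_neg : (0.5665 : ℝ) + Real.log 0.5665 < 0 := by
  have h : Real.log 0.5665 < -0.5665 := by
    rw [Real.log_lt_iff_lt_exp (by norm_num), Real.exp_neg, lt_inv_comm₀ (by norm_num)
      (Real.exp_pos _)]
    refine (Real.exp_bound' (by norm_num) (by norm_num) (n := 6) (by norm_num)).trans_lt ?_
    norm_num [Finset.sum_range_succ, Nat.factorial]
  linarith

theorem add_log_pos : 0 < (0.5675 : ℝ) + Real.log 0.5675 := by
  have h : -0.5675 < Real.log 0.5675 := by
    rw [Real.lt_log_iff_exp_lt (by norm_num), Real.exp_neg, inv_lt_comm₀ (Real.exp_pos _)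
      (by norm_num)]
    refine lt_of_lt_of_le ?_ (Real.sum_le_exp_of_nonneg (by norm_num) 6)
    norm_num [Finset.sum_range_succ, Nat.factorial]
  linarith

theorem exists_add_log_eq_zero : ∃ β : ℝ, 0 < β ∧ β + Real.log β = 0 := by
  have hcont : ContinuousOn (fun x : ℝ => x + Real.log x) (Set.Icc 0.5665 0.5675) :=
    continuousOn_id.add (Real.continuousOn_log.mono fun x hx => by
      have := hx.1
      simp only [Set.mem_compl_iff, Set.mem_singleton_iff]
      rintro rfl
      norm_num at this)
  obtain ⟨β, hβ, h⟩ := intermediate_value_Icc (by norm_num) hcont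
    ⟨add_log_neg.le, add_log_pos.le⟩
  exact ⟨β, lt_of_lt_of_le (by norm_num) hβ.1, h⟩

theorem parameter_eq_iff (β : ℝ) : 1 + Real.log (1 / β) = 1 + β ↔ β + Real.log β = 0 := by
  rw [one_div, Real.log_inv]
  constructor <;> intro h <;> linarith

theorem abs_parameter_sub_lt {β : ℝ} (hβ : 0 < β) (h : β + Real.log β = 0) :
    |(1 + β) - 1.567| < 0.0005 := by
  have h₁ : 0.5665 < β := (strictMonoOn_add_log.lt_iff_lt (Set.mem_Ioi.2 (by norm_num)) hβ).1
    (add_log_neg.trans_eq h.symm)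
  have h₂ : β < 0.5675 := (strictMonoOn_add_log.lt_iff_lt hβ (Set.mem_Ioi.2 (by norm_num))).1
    (h.trans_lt add_log_pos)
  rw [abs_lt]
  constructor <;> linarith

end Parameter

end KBCP

theorem mainTheorem6 :
    (∃! β : ℝ, 0 < β ∧ 1 + Real.log (1 / β) = 1 + β) ∧
    ∀ β : ℝ, 0 < β → 1 + Real.log (1 / β) = 1 + β →
      |(1 + β) - 1.567| < 0.0005 ∧
      KBCP.IsBifactorApproximation (KBCP.twoSided β) (1 + β) (1 + β) := by
  simp only [KBCP.parameter_eq_iff]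
  refine ⟨?_, fun β hβ h => ⟨KBCP.abs_parameter_sub_lt hβ h, ?_⟩⟩
  · obtain ⟨β, hβ, h⟩ := KBCP.exists_add_log_eq_zero
    exact ⟨β, ⟨hβ, h⟩, fun γ hγ =>
      KBCP.strictMonoOn_add_log.injOn hγ.1 hβ (hγ.2.trans h.symm)⟩
  · intro V E _ _ _ k I hI
    exact KBCP.twoSided_computes hβ h hI
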